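/- For $d\in\mathbb N$ let $M_d$ denote the complex $d\times d$ matrices and let "positive" mean positive semidefinite. A linear map $\Phi:M_m\to M_n$ is positive if it maps positive matrices to positive matrices, $k$-positive if $\mathrm{id}_k\otimes\Phi:M_k\otimes M_m\to M_k\otimes M_n$ is positive, and completely positive (CP) if it is $k$-positive for every $k\ge 1$; write $\mathcal P(m,n)$ and $\mathcal{CP}(m,n)$ for the sets of positive and of CP maps $M_m\to M_n$. A CP map $\Phi:M_m\to M_n$ is $k$-partially entanglement breaking ($k$-PEB) if $\Phi(X)=\sum_i V_i^*XV_i$ for finitely many $V_i\in M_{m\times n}$ of rank at most $k$; write $\mathcal{PEB}_k(m)$ for the set of $k$-PEB maps $M_m\to M_m$. A linear map $\Phi:M_m\to M_n$ is $k$-entanglement breaking if it is $k$-positive and for every positive $X\in M_k\otimes M_m$ the matrix $(\mathrm{id}_k\otimes\Phi)(X)$ is separable, i.e. a finite sum $\sum_i A_i\otimes B_i$ with $A_i\in M_k$ and $B_i\in M_n$ positive; write $\mathcal{EB}_k(m,n)$ for the set of these maps. With $C_\Phi=\sum_{i,j}E_{ij}\otimes\Phi(E_{ij})$ the Choi matrix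 of $\Phi$ (where $E_{ij}$ are the matrix units of $M_m$), the dual cone of a set $\mathcal C\subseteq\mathcal P(m,n)$ is $$\mathcal C^\circ=\{\Gamma\in\mathcal P(m,n):\ \operatorname{tr}(C_\Gamma C_\Theta)\ge 0\ \text{ for all }\Theta\in\mathcal C\}.$$ For a set $\mathcal S$ of linear maps $M_m\to M_n$ let $\operatorname{conv}(\mathcal S)$ be the smallest closed convex cone containing $\mathcal S$. **Theorem.** Let $d_1,d_2\in\mathbb N$ and $k\ge 1$. Then $$\mathcal{EB}_k(d_1,d_2)^\circ=\operatorname{conv}\{\Gamma\circ\Psi:\ \Gamma\in\mathcal P(d_1,d_2),\ \Psi\in\mathcal{PEB}_k(d_1)\}=\operatorname{conv}\{\Gamma\circ\Psi:\ \Gamma\in\mathcal P(k,d_2),\ \Psi\in\mathcal{CP}(d_1,k)\}.$$ -/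

import Mathlib

open scoped ComplexOrder Kronecker

noncomputable section

/-- The algebra `M_d` of complex `d × d` matrices. -/
abbrev Mat (d : ℕ) : Type := Matrix (Fin d) (Fin d) ℂ

/-- Matrices of `M_m ⊗ M_n = M_m(M_n)`, indexed by pairs. -/
abbrev Mat₂ (m n : ℕ) : Type := Matrix (Fin m × Fin n) (Fin m × Fin n) ℂ

/-- Complex-linear maps `M_m → M_n`. -/
abbrev MatMap (m n : ℕ) : Type := Mat m →ₗ[ℂ] Mat n

/-- The topology of pointwise convergence on linear maps `M_m → M_n`, i.e. the usual topology
of this finite-dimensional space. -/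
instance MatMap.instTopologicalSpace (m n : ℕ) : TopologicalSpace (MatMap m n) :=
  TopologicalSpace.induced (fun Φ : MatMap m n => (Φ : Mat m → Mat n)) inferInstance

namespace MatMap

/-- `id_k ⊗ Φ : M_k ⊗ M_m → M_k ⊗ M_n`, i.e. `Φ` applied to every block of `X ∈ M_k(M_m)`. -/
def ampliation {m n : ℕ} (k : ℕ) (Φ : MatMap m n) : Mat₂ k m →ₗ[ℂ] Mat₂ k n where
  toFun X := Matrix.of fun p q => Φ (Matrix.of fun i j => X (p.1, i) (q.1, j)) p.2 q.2
  map_add' X Y := by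
    ext p q
    exact congrFun (congrFun (Φ.map_add (Matrix.of fun i j => X (p.1, i) (q.1, j))
      (Matrix.of fun i j => Y (p.1, i) (q.1, j))) p.2) q.2
  map_smul' c X := by
    ext p q
    exact congrFun (congrFun (Φ.map_smul c (Matrix.of fun i j => X (p.1, i) (q.1, j))) p.2) q.2

theorem ampliation_kronecker {m n k : ℕ} (Φ : MatMap m n) (A : Mat k) (B : Mat m) :
    ampliation k Φ (A ⊗ₖ B) = A ⊗ₖ Φ B := by
  ext p q
  exact congrFun (congrFun (Φ.map_smul (A p.1 q.1) B) p.2) q.2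

/-- The Choi matrix `C_Φ = [Φ(E_ij)] = ∑ E_ij ⊗ Φ(E_ij)`. -/
def choi {m n : ℕ} (Φ : MatMap m n) : Mat₂ m n :=
  ∑ i : Fin m, ∑ j : Fin m,
    (Matrix.single i j 1 : Mat m) ⊗ₖ Φ (Matrix.single i j 1)

/-- `Φ` maps positive semidefinite matrices to positive semidefinite matrices. -/
def IsPositive {m n : ℕ} (Φ : MatMap m n) : Prop :=
  ∀ X : Mat m, X.PosSemidef → (Φ X).PosSemidef

/-- `id_k ⊗ Φ` is positive. -/
def IsKPositive {m n : ℕ} (k : ℕ) (Φ : MatMap m n) : Prop :=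
  ∀ X : Mat₂ k m, X.PosSemidef → (ampliation k Φ X).PosSemidef

/-- `Φ` is `k`-positive for every `k ≥ 1`. -/
def IsCP {m n : ℕ} (Φ : MatMap m n) : Prop :=
  ∀ k : ℕ, 1 ≤ k → IsKPositive k Φ

/-- `k`-partially entanglement breaking: a CP-map with a Choi-Kraus decomposition
`Φ(X) = ∑ Vᵢ* X Vᵢ` in which every `Vᵢ` has rank at most `k`. -/
def IsPEB {m n : ℕ} (k : ℕ) (Φ : MatMap m n) : Prop :=
  IsCP Φ ∧ ∃ (r : ℕ) (V : Fin r → Matrix (Fin m) (Fin n) ℂ),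
    (∀ i, (V i).rank ≤ k) ∧ ∀ X : Mat m, Φ X = ∑ i, (V i).conjTranspose * X * V i

end MatMap

/-- `X = ∑ Aᵢ ⊗ Bᵢ` for finitely many positive semidefinite `Aᵢ`, `Bᵢ`. -/
def IsSeparableMatrix {m n : ℕ} (X : Mat₂ m n) : Prop :=
  ∃ (r : ℕ) (A : Fin r → Mat m) (B : Fin r → Mat n),
    (∀ i, (A i).PosSemidef) ∧ (∀ i, (B i).PosSemidef) ∧ X = ∑ i, A i ⊗ₖ B i

namespace MatMap

/-- `k`-entanglement breaking: `k`-positive, and `(id_k ⊗ Φ)(X)` is separable for all `X ≥ 0`. -/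
def IsKEB {m n : ℕ} (k : ℕ) (Φ : MatMap m n) : Prop :=
  IsKPositive k Φ ∧ ∀ X : Mat₂ k m, X.PosSemidef → IsSeparableMatrix (ampliation k Φ X)

/-- `P(m, n)`. -/
def P (m n : ℕ) : Set (MatMap m n) := {Φ | IsPositive Φ}

/-- `CP(m, n)`. -/
def CP (m n : ℕ) : Set (MatMap m n) := {Φ | IsCP Φ}

/-- `PEB_k(m, n)`. -/
def PEB (k m n : ℕ) : Set (MatMap m n) := {Φ | IsPEB k Φ}

/-- `EB_k(m, n)`. -/
def EB (k m n : ℕ) : Set (MatMap m n) := {Φ | IsKEB k Φ}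

/-- The dual cone `C° = {Γ ∈ P(m, n) : tr(C_Γ C_Θ) ≥ 0 for all Θ ∈ C}`; the order on `ℂ` is such
that `0 ≤ z` means that `z` is real and nonnegative. -/
def dualCone {m n : ℕ} (C : Set (MatMap m n)) : Set (MatMap m n) :=
  {Γ | Γ ∈ P m n ∧ ∀ Θ ∈ C, 0 ≤ (choi Γ * choi Θ).trace}

/-- `conv(S)`: the smallest closed convex cone containing `S`, as the intersection of all closed
convex cones (over `ℝ`, containing `0`) that contain `S`. -/
def convCone {m n : ℕ} (S : Set (MatMap m n)) : Set (MatMap m n) :=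
  ⋂₀ {T | ∃ K : PointedCone ℝ (MatMap m n), (K : Set (MatMap m n)) = T ∧ IsClosed T ∧ S ⊆ T}

end MatMap

end

open scoped ComplexOrder Kronecker

noncomputable section

open Matrix

/-! ### Choi matrices, conjugation maps and trace pairings. -/

namespace MatMap

variable {l m n : ℕ}

/-! Write Ad_V(X) = V*XV. Every positive matrix in M_k ⊗ M_m is a finite sum of Choi matrices of
maps Ad_V, and id_k ⊗ Θ sends C_Λ to the Choi matrix of Θ ∘ Λ. Hence Θ is k-entanglement breaking
iff C_{Θ ∘ Ad_V} is separable for every V. Separability is dual to positivity of maps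
(`isSeparableMatrix_of_forall_isPositive`), and Ad_V moves across the trace pairing as Ad_{V*}
(`trace_choi_comp_conj_mul`). So, among maps with Hermitian Choi matrix, EB_k is the polar of the
maps Γ ∘ Ad_V with Γ in P(k, d₂) and V of size d₁ × k.

The bipolar argument (`dualCone_subset_convCone`, by Hahn–Banach) shows that the dual of EB_k is the
closed cone generated by these maps. Both families of the theorem contain all of them and consist of
finite sums of them: by Kraus decomposition for CP maps, by rank factorization for k-PEB maps. -/

theorem choi_apply (Φ : MatMap m n) (p q : Fin m × Fin n) :
    choi Φ p q = Φ (single p.1 q.1 1) p.2 q.2 := by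
  simp [choi, Matrix.sum_apply, kroneckerMap_apply, single_apply, ite_and]

theorem apply_eq_sum_choi (Φ : MatMap m n) (X : Mat m) (a b : Fin n) :
    Φ X a b = ∑ i, ∑ j, X i j * choi Φ (i, a) (j, b) := by
  conv_lhs => rw [matrix_eq_sum_single X]
  simp only [map_sum, Matrix.sum_apply, choi_apply]
  refine Finset.sum_congr rfl fun i _ => Finset.sum_congr rfl fun j _ => ?_
  have : single i j (X i j) = X i j • (single i j 1 : Mat m) := by simp
  rw [this, map_smul, Matrix.smul_apply, smul_eq_mul]

/-- The linear map with prescribed Choi matrix. -/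
def ofChoi (H : Mat₂ m n) : MatMap m n where
  toFun X := of fun a b => ∑ i, ∑ j, X i j * H (i, a) (j, b)
  map_add' X Y := by
    ext a b
    simp [add_mul, Finset.sum_add_distrib]
  map_smul' c X := by
    ext a b
    simp [mul_assoc, Finset.mul_sum]

theorem choi_ofChoi (H : Mat₂ m n) : choi (ofChoi H) = H := by
  ext p q
  simp [choi_apply, ofChoi, single_apply, ite_and]

theorem ofChoi_choi (Φ : MatMap m n) : ofChoi (choi Φ) = Φ := by
  ext1 X
  ext a b
  exact (apply_eq_sum_choi Φ X a b).symm

/-- The Choi–Jamiołkowski isomorphism. -/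
def choiEquiv (m n : ℕ) : MatMap m n ≃ₗ[ℂ] Mat₂ m n where
  toFun := choi
  invFun := ofChoi
  map_add' Φ Ψ := by ext; simp [choi_apply]
  map_smul' c Φ := by ext; simp [choi_apply]
  left_inv := ofChoi_choi
  right_inv := choi_ofChoi

theorem choi_injective : Function.Injective (choi : MatMap m n → Mat₂ m n) :=
  (choiEquiv m n).injective

theorem choi_add (Φ Ψ : MatMap m n) : choi (Φ + Ψ) = choi Φ + choi Ψ :=
  (choiEquiv m n).map_add Φ Ψ

theorem choi_zero : choi (0 : MatMap m n) = 0 := (choiEquiv m n).map_zero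

theorem choi_sum {ι : Type*} (s : Finset ι) (Φ : ι → MatMap m n) :
    choi (∑ i ∈ s, Φ i) = ∑ i ∈ s, choi (Φ i) :=
  map_sum (choiEquiv m n) Φ s

/-- The map `X ↦ V* X V`. -/
def conj (V : Matrix (Fin m) (Fin n) ℂ) : MatMap m n where
  toFun X := Vᴴ * X * V
  map_add' X Y := by rw [Matrix.mul_add, Matrix.add_mul]
  map_smul' c X := by simp

theorem conj_apply (V : Matrix (Fin m) (Fin n) ℂ) (X : Mat m) : conj V X = Vᴴ * X * V := rfl

theorem isPositive_conj (V : Matrix (Fin m) (Fin n) ℂ) : IsPositive (conj V) :=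
  fun _ hX => hX.conjTranspose_mul_mul_same V

theorem IsPositive.comp {Γ : MatMap m n} {Ψ : MatMap l m} (hΓ : IsPositive Γ)
    (hΨ : IsPositive Ψ) : IsPositive (Γ ∘ₗ Ψ) :=
  fun X hX => hΓ _ (hΨ X hX)

theorem conj_comp_conj (V : Matrix (Fin l) (Fin m) ℂ) (W : Matrix (Fin m) (Fin n) ℂ) :
    conj W ∘ₗ conj V = conj (V * W) := by
  ext1 X
  simp [conj_apply, conjTranspose_mul, Matrix.mul_assoc]

theorem conj_apply_apply (V : Matrix (Fin m) (Fin n) ℂ) (X : Mat m) (a b : Fin n) :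
    conj V X a b = ∑ i, ∑ j, star (V i a) * X i j * V j b := by
  simp only [conj_apply, mul_apply, conjTranspose_apply, Finset.sum_mul]
  exact Finset.sum_comm

theorem choi_conj_apply (V : Matrix (Fin m) (Fin n) ℂ) (p q : Fin m × Fin n) :
    choi (conj V) p q = star (V p.1 p.2) * V q.1 q.2 := by
  simp [choi_apply, conj_apply_apply, single_apply, ite_and]

/-- Turns ampliations of `Θ` into compositions with `Θ`, to which the trace adjunction applies. -/
theorem ampliation_choi {k : ℕ} (Θ : MatMap m n) (Λ : MatMap k m) :
    ampliation k Θ (choi Λ) = choi (Θ ∘ₗ Λ) := by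
  ext p q
  rw [choi_apply]
  change Θ _ p.2 q.2 = Θ _ p.2 q.2
  refine congrArg (fun Z => Θ Z p.2 q.2) ?_
  ext i j
  simp [choi_apply]

theorem ampliation_conj {k : ℕ} (V : Matrix (Fin m) (Fin n) ℂ) (X : Mat₂ k m) :
    ampliation k (conj V) X
      = ((1 : Mat k) ⊗ₖ V)ᴴ * X * ((1 : Mat k) ⊗ₖ V) := by
  ext ⟨i, a⟩ ⟨j, b⟩
  change conj V _ a b = _
  rw [conj_apply_apply]
  simp only [mul_apply, conjTranspose_apply, kroneckerMap_apply, Fintype.sum_prod_type,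
    one_apply, Finset.sum_mul, of_apply]
  simp [ite_mul, apply_ite]
  exact Finset.sum_comm

theorem isCP_conj (V : Matrix (Fin m) (Fin n) ℂ) : IsCP (conj V) := by
  intro k _ X hX
  rw [ampliation_conj]
  exact hX.conjTranspose_mul_mul_same _

theorem posSemidef_choi_id : (choi (LinearMap.id : MatMap m m)).PosSemidef := by
  have h : choi (LinearMap.id : MatMap m m)
      = vecMulVec (star fun p : Fin m × Fin m => (1 : Mat m) p.1 p.2)
        (fun p => (1 : Mat m) p.1 p.2) := by
    ext p q
    simp only [choi_apply, LinearMap.id_coe, id, single_apply, vecMulVec_apply, Pi.star_apply,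
      one_apply]
    split_ifs <;> simp_all
  rw [h]
  exact posSemidef_vecMulVec_star_self _

theorem exists_eq_sum_choi_conj {X : Mat₂ m n} (hX : X.PosSemidef) :
    ∃ (r : ℕ) (V : Fin r → Matrix (Fin m) (Fin n) ℂ), X = ∑ s, choi (conj (V s)) := by
  obtain ⟨r, v, rfl⟩ := posSemidef_iff_eq_sum_vecMulVec.mp hX
  -- Each vector is reshaped into a matrix; the conjugate matches the starred first factor in
  -- `choi_conj_apply`.
  refine ⟨r, fun s => of fun i a => star (v s (i, a)), ?_⟩
  refine Finset.sum_congr rfl fun s _ => ?_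
  ext p q
  simp [choi_conj_apply, vecMulVec_apply]

theorem IsCP.exists_eq_sum_conj {Ψ : MatMap m n} (h : IsCP Ψ) :
    ∃ (r : ℕ) (V : Fin r → Matrix (Fin m) (Fin n) ℂ), Ψ = ∑ s, conj (V s) := by
  have hpos : (choi Ψ).PosSemidef := by
    -- Complete positivity is tested at level `m`, which must be at least 1; for `m = 0` the Choi
    -- matrix is empty.
    rcases Nat.eq_zero_or_pos m with rfl | hm
    · rw [Subsingleton.elim (choi Ψ) 0]
      exact PosSemidef.zero
    · have := h m hm _ posSemidef_choi_id
      rwa [ampliation_choi, LinearMap.comp_id] at this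
  obtain ⟨r, V, hV⟩ := exists_eq_sum_choi_conj hpos
  exact ⟨r, V, choi_injective (by rw [hV, choi_sum])⟩

theorem choi_comp_conj (Θ : MatMap m n) (W : Matrix (Fin l) (Fin m) ℂ) :
    choi (Θ ∘ₗ conj W) = (Wᵀ ⊗ₖ (1 : Mat n))ᴴ * choi Θ * (Wᵀ ⊗ₖ (1 : Mat n)) := by
  ext ⟨i, a⟩ ⟨j, b⟩
  rw [choi_apply, LinearMap.comp_apply, apply_eq_sum_choi]
  simp only [mul_apply, conjTranspose_apply, kroneckerMap_apply, Fintype.sum_prod_type,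
    one_apply, Finset.sum_mul, transpose_apply, conj_apply_apply]
  simp [single_apply, ite_and, apply_ite]
  rw [Finset.sum_comm]
  refine Finset.sum_congr rfl fun x _ => Finset.sum_congr rfl fun y _ => ?_
  ring

/-- Precomposing with Ad_W conjugates the Choi matrix by Wᵀ ⊗ 1, and the trace is cyclic. -/
theorem trace_choi_comp_conj_mul {k : ℕ} (Θ : MatMap m n) (Γ : MatMap k n)
    (W : Matrix (Fin k) (Fin m) ℂ) :
    (choi (Θ ∘ₗ conj W) * choi Γ).trace = (choi Θ * choi (Γ ∘ₗ conj Wᴴ)).trace := by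
  have h : (Wᴴᵀ ⊗ₖ (1 : Mat n)) = (Wᵀ ⊗ₖ (1 : Mat n))ᴴ := by
    rw [conjTranspose_kronecker, conjTranspose_one]
    rfl
  rw [choi_comp_conj, choi_comp_conj, h, conjTranspose_conjTranspose]
  simp only [Matrix.mul_assoc]
  rw [trace_mul_comm]
  simp only [Matrix.mul_assoc]

theorem trace_kronecker_mul_choi (Γ : MatMap m n) (A : Mat m) (B : Mat n) :
    ((A ⊗ₖ B) * choi Γ).trace = (Γ Aᵀ * B).trace := by
  simp only [trace, diag_apply, mul_apply, kroneckerMap_apply, Fintype.sum_prod_type,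
    apply_eq_sum_choi Γ, transpose_apply, Finset.sum_mul]
  have e : ∀ F : Fin m → Fin n → Fin m → Fin n → ℂ,
      ∑ i, ∑ a, ∑ j, ∑ b, F i a j b = ∑ b, ∑ a, ∑ j, ∑ i, F i a j b := by
    intro F
    simp only [← Fintype.sum_prod_type']
    let σ : (Fin m × Fin n × Fin m × Fin n) ≃ (Fin n × Fin n × Fin m × Fin m) :=
      ⟨fun x => (x.2.2.2, x.2.1, x.2.2.1, x.1), fun x => (x.2.2.2, x.2.1, x.2.2.1, x.1),
        fun _ => rfl, fun _ => rfl⟩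
    exact Fintype.sum_equiv σ (fun x => F x.1 x.2.1 x.2.2.1 x.2.2.2)
      (fun x => F x.2.2.2 x.2.1 x.2.2.1 x.1) fun _ => rfl
  rw [e]
  refine Finset.sum_congr rfl fun x _ => Finset.sum_congr rfl fun y _ =>
    Finset.sum_congr rfl fun z _ => Finset.sum_congr rfl fun w _ => ?_
  ring

end MatMap

theorem Matrix.PosSemidef.trace_mul_nonneg {n : ℕ} {A B : Mat n} (hA : A.PosSemidef)
    (hB : B.PosSemidef) : 0 ≤ (A * B).trace := by
  obtain ⟨r, v, rfl⟩ := posSemidef_iff_eq_sum_vecMulVec.mp hB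
  rw [Matrix.mul_sum, trace_sum]
  refine Finset.sum_nonneg fun s _ => ?_
  rw [mul_vecMulVec, trace_vecMulVec, dotProduct_comm]
  exact hA.dotProduct_mulVec_nonneg (v s)

namespace MatMap

variable {m n : ℕ}

theorem IsPositive.trace_mul_choi_nonneg {Γ : MatMap m n} (hΓ : IsPositive Γ) {Y : Mat₂ m n}
    (hY : IsSeparableMatrix Y) : 0 ≤ (Y * choi Γ).trace := by
  obtain ⟨r, A, B, hA, hB, rfl⟩ := hY
  rw [Matrix.sum_mul, trace_sum]
  refine Finset.sum_nonneg fun i _ => ?_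
  rw [trace_kronecker_mul_choi]
  exact (hΓ _ (hA i).transpose).trace_mul_nonneg (hB i)

/-- Polarization: Γ(Z*Z) is Hermitian, and Z = 1 + X, 1 + iX isolate X + X* and i(X − X*) once the
terms from Z = 1, X are removed. -/
theorem IsPositive.map_conjTranspose {Γ : MatMap m n} (hΓ : IsPositive Γ) (X : Mat m) :
    Γ Xᴴ = (Γ X)ᴴ := by
  have key : ∀ Z : Mat m, Γ (Zᴴ * Z) = (Γ (Zᴴ * Z))ᴴ := fun Z =>
    (hΓ _ (posSemidef_conjTranspose_mul_self Z)).isHermitian.symm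
  have h1 := key 1
  have h2 := key X
  have h3 := key (1 + X)
  have h4 := key (1 + Complex.I • X)
  simp only [conjTranspose_add, conjTranspose_one, conjTranspose_smul, Matrix.add_mul,
    Matrix.mul_add, Matrix.one_mul, Matrix.mul_one, map_add, map_smul, Matrix.smul_mul,
    Matrix.mul_smul] at h1 h2 h3 h4
  ext a b
  have e1 := congrFun (congrFun h1 a) b
  have e2 := congrFun (congrFun h2 a) b
  have e3 := congrFun (congrFun h3 a) b
  have e4 := congrFun (congrFun h4 a) b
  simp only [Matrix.add_apply, Matrix.smul_apply, conjTranspose_apply, smul_eq_mul,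
    Complex.star_def, Complex.conj_I, map_neg, neg_neg] at e1 e2 e3 e4 ⊢
  linear_combination (1 / 2) * e3 + Complex.I / 2 * e4 - (1 / 2 + Complex.I / 2) * (e1 + e2)
    + (Γ Xᴴ a b - Γ X a b + (starRingEnd ℂ) (Γ Xᴴ b a) - (starRingEnd ℂ) (Γ X b a)) / 2
      * Complex.I_sq + Complex.I / 2 * (e2 + Complex.I ^ 2 * e2)

theorem IsPositive.isHermitian_choi {Γ : MatMap m n} (hΓ : IsPositive Γ) :
    (choi Γ).IsHermitian := by
  ext p q
  have := congrFun (congrFun (hΓ.map_conjTranspose (single q.1 p.1 1)) p.2) q.2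
  simp only [conjTranspose_single, star_one, conjTranspose_apply] at this
  rw [conjTranspose_apply, choi_apply, choi_apply, this]

end MatMap

/-! ### Closedness of cones with a compact base. -/

section ClosedCone

variable {E : Type*} [AddCommGroup E] [Module ℝ E] [TopologicalSpace E]
  [IsTopologicalAddGroup E] [ContinuousSMul ℝ E]

/-- In finite dimension the convex hull of a compact set is compact. -/
theorem IsCompact.isCompact_convexHull [Module.Finite ℝ E] {s : Set E} (hs : IsCompact s) :
    IsCompact (convexHull ℝ s) := by
  let N := Module.finrank ℝ E + 1
  let F : ∀ r : ℕ, (Fin r → ℝ) × (Fin r → E) → E := fun r p => ∑ i, p.1 i • p.2 i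
  have hF : ∀ r, Continuous (F r) := fun r => by fun_prop
  -- Carathéodory: at most `N` points are needed, so the hull is a finite union of compact images.
  have heq : convexHull ℝ s = ⋃ r ∈ Set.Iic N,
      F r '' (stdSimplex ℝ (Fin r) ×ˢ Set.univ.pi fun _ => s) := by
    ext x
    simp only [Set.mem_iUnion, Set.mem_image, exists_prop]
    constructor
    · intro hx
      obtain ⟨ι, _, z, w, hz, hind, hw, hw1, rfl⟩ := eq_pos_convex_span_of_mem_convexHull hx
      let e := Fintype.equivFin ι
      have hcard : Fintype.card ι ≤ N :=
        hind.card_le_finrank_succ.trans (Nat.succ_le_succ (Submodule.finrank_le _))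
      refine ⟨Fintype.card ι, hcard, (w ∘ e.symm, z ∘ e.symm),
        ⟨⟨fun i => (hw _).le, ?_⟩, fun i _ => hz ⟨_, rfl⟩⟩, ?_⟩
      · exact (e.symm.sum_comp w).trans hw1
      · exact e.symm.sum_comp fun i => w i • z i
    · rintro ⟨r, -, p, ⟨⟨h0, h1⟩, hp⟩, rfl⟩
      exact (convex_convexHull ℝ s).sum_mem (fun i _ => h0 i) h1
        fun i _ => subset_convexHull ℝ s (hp i trivial)
  rw [heq]
  exact (Set.finite_Iic N).isCompact_biUnion fun r _ =>
    ((isCompact_stdSimplex ℝ (Fin r)).prod (isCompact_univ_pi fun _ => hs)).image (hF r)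

/-- A cone spanned by a compact set on which some functional is positive is closed. -/
theorem IsCompact.isClosed_hull [Module.Finite ℝ E] [T2Space E] [FirstCountableTopology E]
    {s : Set E} (hs : IsCompact s) (φ : E →L[ℝ] ℝ) (hφ : ∀ x ∈ s, 0 < φ x) :
    IsClosed (PointedCone.hull ℝ s : Set E) := by
  have hC := hs.isCompact_convexHull
  have hφC : ∀ x ∈ convexHull ℝ s, 0 < φ x := fun x hx =>
    convexHull_min (t := {x | 0 < φ x}) hφ (convex_halfSpace_gt φ.isLinear 0) hx
  -- The separate `{0}` matters only when `s` is empty.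
  have heq : (PointedCone.hull ℝ s : Set E)
      = {0} ∪ {x | ∃ t : ℝ, 0 ≤ t ∧ ∃ c ∈ convexHull ℝ s, x = t • c} := by
    apply Set.Subset.antisymm
    · intro x hx
      induction hx using Submodule.span_induction with
      | mem x hx => exact Or.inr ⟨1, zero_le_one, x, subset_convexHull ℝ s hx, (one_smul _ _).symm⟩
      | zero => exact Or.inl rfl
      | add x y _ _ hx hy =>
        rcases hx with rfl | ⟨t, ht, c, hc, rfl⟩
        · simpa using hy
        rcases hy with rfl | ⟨u, hu, d, hd, rfl⟩
        · rw [add_zero]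
          exact Or.inr ⟨t, ht, c, hc, rfl⟩
        rcases (add_nonneg ht hu).eq_or_lt with h | h
        · have h1 : t = 0 := by linarith
          have h2 : u = 0 := by linarith
          left
          simp [h1, h2]
        · refine Or.inr ⟨t + u, h.le, (t / (t + u)) • c + (u / (t + u)) • d,
            convex_convexHull ℝ s hc hd (by positivity) (by positivity) (by field_simp), ?_⟩
          rw [smul_add, smul_smul, smul_smul, mul_div_cancel₀ _ h.ne', mul_div_cancel₀ _ h.ne']
      | smul a x _ hx =>
        rcases hx with rfl | ⟨t, ht, c, hc, rfl⟩
        · left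
          simp
        · exact Or.inr ⟨a * t, mul_nonneg a.2 ht, c, hc, by rw [mul_smul]; rfl⟩
    · rintro x (rfl | ⟨t, ht, c, hc, rfl⟩)
      · exact zero_mem _
      · exact (PointedCone.hull ℝ s).smul_mem ht
          (convexHull_min Submodule.subset_span (PointedCone.hull ℝ s).convex hc)
  rw [heq]
  refine isClosed_singleton.union ?_
  refine IsSeqClosed.isClosed fun x y hx hxy => ?_
  choose t ht c hc hx using hx
  obtain ⟨c₀, hc₀, g, hg, hlim⟩ := hC.isSeqCompact hc
  -- Positivity of `φ` on the base recovers the scalars, so they converge along the subsequence on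
  -- which `c` does.
  have htn : ∀ i, t i = φ (x i) / φ (c i) := fun i => by
    rw [hx i, map_smul, smul_eq_mul, mul_div_cancel_right₀ _ (hφC _ (hc i)).ne']
  have hxg := hxy.comp hg.tendsto_atTop
  have htlim : Filter.Tendsto (fun i => t (g i)) Filter.atTop (nhds (φ y / φ c₀)) := by
    simp only [htn]
    exact ((φ.continuous.tendsto y).comp hxg).div ((φ.continuous.tendsto c₀).comp hlim)
      (hφC _ hc₀).ne'
  refine ⟨φ y / φ c₀, ge_of_tendsto' htlim fun i => ht _, c₀, hc₀, ?_⟩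
  refine tendsto_nhds_unique hxg ((htlim.smul hlim).congr fun i => ?_)
  exact (hx _).symm

end ClosedCone

/-! ### The closed cone of separable matrices. -/

section Separable

variable {m n : ℕ}

theorem IsSeparableMatrix.zero : IsSeparableMatrix (0 : Mat₂ m n) :=
  ⟨0, Fin.elim0, Fin.elim0, fun i => i.elim0, fun i => i.elim0, by simp⟩

theorem Matrix.PosSemidef.isSeparableMatrix_kronecker {A : Mat m} {B : Mat n}
    (hA : A.PosSemidef) (hB : B.PosSemidef) : IsSeparableMatrix (A ⊗ₖ B) :=
  ⟨1, fun _ => A, fun _ => B, fun _ => hA, fun _ => hB, by simp⟩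

theorem IsSeparableMatrix.add {X Y : Mat₂ m n} (hX : IsSeparableMatrix X)
    (hY : IsSeparableMatrix Y) : IsSeparableMatrix (X + Y) := by
  obtain ⟨r, A, B, hA, hB, rfl⟩ := hX
  obtain ⟨s, A', B', hA', hB', rfl⟩ := hY
  refine ⟨r + s, Fin.append A A', Fin.append B B', fun i => ?_, fun i => ?_, ?_⟩
  · refine Fin.addCases (fun j => ?_) (fun j => ?_) i
    · simpa using hA j
    · simpa using hA' j
  · refine Fin.addCases (fun j => ?_) (fun j => ?_) i
    · simpa using hB j
    · simpa using hB' j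
  · simp [Fin.sum_univ_add]

theorem IsSeparableMatrix.smul {X : Mat₂ m n} (hX : IsSeparableMatrix X) {t : ℝ} (ht : 0 ≤ t) :
    IsSeparableMatrix (t • X) := by
  obtain ⟨r, A, B, hA, hB, rfl⟩ := hX
  refine ⟨r, fun i => t • A i, B, fun i => (hA i).smul ht, hB, ?_⟩
  rw [Finset.smul_sum]
  exact Finset.sum_congr rfl fun i _ => (smul_kronecker t (A i) (B i)).symm

theorem IsSeparableMatrix.sum {ι : Type*} (s : Finset ι) {X : ι → Mat₂ m n}
    (hX : ∀ i ∈ s, IsSeparableMatrix (X i)) : IsSeparableMatrix (∑ i ∈ s, X i) :=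
  Finset.sum_induction X IsSeparableMatrix (fun _ _ => IsSeparableMatrix.add)
    IsSeparableMatrix.zero hX

theorem IsSeparableMatrix.posSemidef {X : Mat₂ m n} (hX : IsSeparableMatrix X) :
    X.PosSemidef := by
  obtain ⟨r, A, B, hA, hB, rfl⟩ := hX
  exact posSemidef_sum _ fun i _ => (hA i).kronecker (hB i)

/-- The cone of separable matrices. -/
def separableCone (m n : ℕ) : PointedCone ℝ (Mat₂ m n) where
  carrier := {X | IsSeparableMatrix X}
  add_mem' := IsSeparableMatrix.add
  zero_mem' := IsSeparableMatrix.zero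
  smul_mem' a _ hX := hX.smul a.2

/-- The products `X*X ⊗ Y*Y` with `X`, `Y` in the unit sphere of the sup norm on entries. -/
def separableBase (m n : ℕ) : Set (Mat₂ m n) :=
  (fun p : (Fin m → Fin m → ℂ) × (Fin n → Fin n → ℂ) =>
      ((of p.1)ᴴ * of p.1) ⊗ₖ ((of p.2)ᴴ * of p.2)) ''
    (Metric.sphere 0 1 ×ˢ Metric.sphere 0 1)

theorem isCompact_separableBase : IsCompact (separableBase m n) := by
  refine ((isCompact_sphere _ _).prod (isCompact_sphere _ _)).image ?_
  refine continuous_matrix fun p q => ?_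
  simp only [kroneckerMap_apply, mul_apply, conjTranspose_apply, of_apply]
  fun_prop

/-- The real part of the trace. -/
def reTrace (ι : Type*) [Fintype ι] : Matrix ι ι ℂ →L[ℝ] ℝ where
  toFun X := X.trace.re
  map_add' X Y := by simp
  map_smul' c X := by simp [trace_smul]
  cont := Complex.continuous_re.comp (Continuous.matrix_trace continuous_id)

theorem reTrace_pos_of_mem_separableBase {X : Mat₂ m n} (hX : X ∈ separableBase m n) :
    0 < reTrace _ X := by
  obtain ⟨⟨A, B⟩, ⟨hA, hB⟩, rfl⟩ := hX
  have pos : ∀ {d : ℕ} (C : Fin d → Fin d → ℂ), C ∈ Metric.sphere 0 1 →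
      0 < ((of C)ᴴ * of C).trace := by
    intro d C hC
    refine lt_of_le_of_ne (posSemidef_conjTranspose_mul_self _).trace_nonneg fun h => ?_
    have h0 : of C = 0 := trace_conjTranspose_mul_self_eq_zero_iff.mp h.symm
    have h0' : C = 0 := h0
    simp [h0'] at hC
  have h := mul_pos (pos A hA) (pos B hB)
  rw [← trace_kronecker] at h
  exact (Complex.pos_iff.mp h).1

theorem exists_smul_of_posSemidef {A : Mat m} (hA : A.PosSemidef) (h0 : A ≠ 0) :
    ∃ t : ℝ, 0 ≤ t ∧ ∃ C ∈ Metric.sphere (0 : Fin m → Fin m → ℂ) 1,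
      A = t • ((of C)ᴴ * of C) := by
  obtain ⟨B, rfl⟩ : ∃ B : Mat m, A = Bᴴ * B := by
    open scoped MatrixOrder in
    exact CStarAlgebra.nonneg_iff_eq_star_mul_self.mp hA.nonneg
  let C : Fin m → Fin m → ℂ := B
  have hC : ‖C‖ ≠ 0 := by
    rw [norm_ne_zero_iff]
    intro h
    apply h0
    have : B = 0 := h
    simp [this]
  refine ⟨‖C‖ ^ 2, by positivity, ‖C‖⁻¹ • C, ?_, ?_⟩
  · simp [norm_smul, hC]
  · have : of (‖C‖⁻¹ • C) = ‖C‖⁻¹ • B := rfl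
    rw [this, conjTranspose_smul, star_trivial, smul_mul_smul_comm, smul_smul]
    have : ‖C‖ ^ 2 * (‖C‖⁻¹ * ‖C‖⁻¹) = 1 := by field_simp
    rw [this, one_smul]

/-- Each nonzero positive factor is a multiple of C*C with C normalized. The base is compact and has
positive trace, so the cone is closed. -/
theorem separableCone_eq_hull : separableCone m n = PointedCone.hull ℝ (separableBase m n) := by
  apply le_antisymm
  · rintro X ⟨r, A, B, hA, hB, rfl⟩
    refine Submodule.sum_mem _ fun i _ => ?_
    by_cases hA0 : A i = 0
    · simp [hA0]
    by_cases hB0 : B i = 0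
    · simp [hB0]
    obtain ⟨t, ht, C, hC, hAC⟩ := exists_smul_of_posSemidef (hA i) hA0
    obtain ⟨u, hu, D, hD, hBD⟩ := exists_smul_of_posSemidef (hB i) hB0
    rw [hAC, hBD, smul_kronecker, kronecker_smul, smul_smul]
    exact (PointedCone.hull ℝ (separableBase m n)).smul_mem
      (mul_nonneg ht hu)
      (Submodule.subset_span ⟨(C, D), ⟨hC, hD⟩, rfl⟩)
  · refine Submodule.span_le.mpr ?_
    rintro _ ⟨p, -, rfl⟩
    exact (posSemidef_conjTranspose_mul_self _).isSeparableMatrix_kronecker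
      (posSemidef_conjTranspose_mul_self _)

instance Matrix.instFirstCountableTopology {ι κ α : Type*} [Countable ι] [Countable κ]
    [TopologicalSpace α] [FirstCountableTopology α] :
    FirstCountableTopology (Matrix ι κ α) :=
  inferInstanceAs (FirstCountableTopology (ι → κ → α))

instance Matrix.instLocallyConvexSpace {ι κ : Type*} :
    LocallyConvexSpace ℝ (Matrix ι κ ℂ) :=
  inferInstanceAs (LocallyConvexSpace ℝ (ι → κ → ℂ))

theorem isClosed_separableCone : IsClosed (separableCone m n : Set (Mat₂ m n)) := by
  rw [separableCone_eq_hull]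
  exact isCompact_separableBase.isClosed_hull (reTrace _)
    fun _ => reTrace_pos_of_mem_separableBase

end Separable

/-! ### Duality between separable matrices and positive maps; rank factorization. -/

/-- Real-linear functionals on matrices are, on Hermitian matrices, trace pairings with a
Hermitian matrix. -/
theorem Matrix.exists_isHermitian_trace_mul_eq {ι : Type*} [Fintype ι]
    (f : Matrix ι ι ℂ →ₗ[ℝ] ℝ) :
    ∃ H : Matrix ι ι ℂ, H.IsHermitian ∧
      ∀ Z : Matrix ι ι ℂ, Z.IsHermitian → (Z * H).trace = f Z := by
  classical
  let g : Matrix ι ι ℂ →ₗ[ℂ] ℂ := Module.Dual.extendRCLike (𝕜 := ℂ) f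
  have hre : ∀ Z, (g Z).re = f Z := fun Z => Module.Dual.re_extendRCLike_apply (𝕜 := ℂ) f Z
  let H : Matrix ι ι ℂ := of fun a b => g (single b a 1)
  have hg : ∀ Z, (Z * H).trace = g Z := by
    intro Z
    conv_rhs => rw [matrix_eq_sum_single Z]
    simp only [map_sum, trace, diag_apply, mul_apply, H, of_apply]
    refine Finset.sum_congr rfl fun i _ => Finset.sum_congr rfl fun j _ => ?_
    have : single i j (Z i j) = Z i j • (single i j 1 : Matrix ι ι ℂ) := by simp
    rw [this, map_smul, smul_eq_mul]
  -- For Hermitian Z, tr(ZH*) is the conjugate of tr(ZH), so the Hermitian part of H yields Re g(Z)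
  -- = f(Z).
  refine ⟨(1 / 2 : ℝ) • (H + Hᴴ), ?_, fun Z hZ => ?_⟩
  · rw [IsHermitian, conjTranspose_smul, conjTranspose_add, conjTranspose_conjTranspose,
      star_trivial, add_comm]
  · have h2 : (Z * Hᴴ).trace = star (g Z) := by
      rw [← hg, ← trace_conjTranspose, conjTranspose_mul, hZ.eq, trace_mul_comm]
    rw [Matrix.mul_smul, Matrix.mul_add, trace_smul, trace_add, h2, hg, ← hre]
    apply Complex.ext <;> simp
    ring

/-- Positive maps detect separability. -/
theorem isSeparableMatrix_of_forall_isPositive {m n : ℕ} {Y : Mat₂ m n} (hY : Y.IsHermitian)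
    (h : ∀ Γ : MatMap m n, Γ.IsPositive → 0 ≤ (Y * MatMap.choi Γ).trace.re) :
    IsSeparableMatrix Y := by
  by_contra hns
  let C : ProperCone ℝ (Mat₂ m n) := ⟨separableCone m n, isClosed_separableCone⟩
  obtain ⟨f, hf, hfY⟩ := C.hyperplane_separation_point (x₀ := Y) hns
  obtain ⟨H, hH, hfH⟩ := Matrix.exists_isHermitian_trace_mul_eq (f : Mat₂ m n →ₗ[ℝ] ℝ)
  -- Nonnegativity of the separating functional on products A ⊗ B is exactly positivity of the map
  -- with Choi matrix `H`.
  have hΓ : (MatMap.ofChoi H).IsPositive := by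
    intro X hX
    have key : ∀ B : Mat n, B.PosSemidef → 0 ≤ (MatMap.ofChoi H X * B).trace := by
      intro B hB
      have hs := hX.transpose.isSeparableMatrix_kronecker hB
      have := MatMap.trace_kronecker_mul_choi (MatMap.ofChoi H) Xᵀ B
      rw [transpose_transpose, MatMap.choi_ofChoi] at this
      rw [← this, hfH _ hs.posSemidef.isHermitian]
      exact_mod_cast hf _ hs
    refine PosSemidef.of_dotProduct_mulVec_nonneg ?_ fun v => ?_
    · ext a b
      simp only [conjTranspose_apply, MatMap.ofChoi, LinearMap.coe_mk, AddHom.coe_mk, of_apply,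
        star_sum, star_mul']
      rw [Finset.sum_comm]
      refine Finset.sum_congr rfl fun i _ => Finset.sum_congr rfl fun j _ => ?_
      rw [← hX.isHermitian.apply i j, ← hH.apply (i, a) (j, b)]
    · have := key _ (posSemidef_vecMulVec_self_star v)
      rwa [mul_vecMulVec, trace_vecMulVec, dotProduct_comm] at this
  have h1 := h _ hΓ
  rw [MatMap.choi_ofChoi, hfH Y hY] at h1
  exact absurd hfY (not_lt.mpr (by simpa using h1))

/-- Rank factorization. -/
theorem Matrix.exists_mul_eq_of_rank_le {m n k : ℕ} (V : Matrix (Fin m) (Fin n) ℂ)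
    (hV : V.rank ≤ k) :
    ∃ (B : Matrix (Fin m) (Fin k) ℂ) (C : Matrix (Fin k) (Fin n) ℂ), V = B * C := by
  have hle : Module.rank ℂ (LinearMap.range V.mulVecLin) ≤ Module.rank ℂ (Fin k → ℂ) := by
    rw [← Module.finrank_eq_rank, ← Module.finrank_eq_rank, Module.finrank_fin_fun]
    exact_mod_cast hV
  obtain ⟨f, hf⟩ := rank_le_iff_exists_linearMap.mp hle
  obtain ⟨g, hg⟩ := f.exists_leftInverse_of_injective (LinearMap.ker_eq_bot.mpr hf)
  -- `f` embeds the range of `V` in ℂ^k and `g` retracts it, so `V` factors through ℂ^k.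
  refine ⟨LinearMap.toMatrix' ((LinearMap.range V.mulVecLin).subtype ∘ₗ g),
    LinearMap.toMatrix' (f ∘ₗ V.mulVecLin.rangeRestrict), ?_⟩
  rw [← LinearMap.toMatrix'_comp, LinearMap.comp_assoc, ← LinearMap.comp_assoc _ f g, hg,
    LinearMap.id_comp, LinearMap.subtype_comp_codRestrict]
  exact (LinearMap.toMatrix'_toLin' V).symm

/-! ### Dual cones of maps and the bipolar argument. -/

namespace MatMap

variable {m n k : ℕ}

instance instIsTopologicalAddGroup : IsTopologicalAddGroup (MatMap m n) :=
  topologicalAddGroup_induced (LinearMap.ltoFun ℂ (Mat m) (Mat n) ℂ)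

instance instContinuousSMulReal : ContinuousSMul ℝ (MatMap m n) :=
  continuousSMul_induced ((LinearMap.ltoFun ℂ (Mat m) (Mat n) ℂ).restrictScalars ℝ)

instance instLocallyConvexSpace : LocallyConvexSpace ℝ (MatMap m n) :=
  LocallyConvexSpace.induced ((LinearMap.ltoFun ℂ (Mat m) (Mat n) ℂ).restrictScalars ℝ)

theorem continuous_eval (X : Mat m) : Continuous fun Φ : MatMap m n => Φ X :=
  (continuous_apply X).comp continuous_induced_dom

theorem continuous_choi : Continuous (choi : MatMap m n → Mat₂ m n) :=
  continuous_matrix fun p q => by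
    simp only [choi_apply]
    exact (continuous_eval _).matrix_elem _ _

theorem IsPositive.add {Γ Θ : MatMap m n} (hΓ : IsPositive Γ) (hΘ : IsPositive Θ) :
    IsPositive (Γ + Θ) := fun X hX => (hΓ X hX).add (hΘ X hX)

theorem isClosed_P : IsClosed (P m n) := by
  have : P m n = ⋂ (X : Mat m) (_ : X.PosSemidef), {Φ : MatMap m n | (Φ X).IsHermitian} ∩
      ⋂ v : Fin n → ℂ, {Φ | 0 ≤ star v ⬝ᵥ (Φ X *ᵥ v)} := by
    ext Φ
    simp only [P, IsPositive, posSemidef_iff_dotProduct_mulVec, Set.mem_ofPred_eq, Set.mem_iInter,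
      Set.mem_inter_iff]
  rw [this]
  refine isClosed_iInter fun X => isClosed_iInter fun _ => IsClosed.inter ?_
    (isClosed_iInter fun v => ?_)
  · exact isClosed_eq (continuous_eval X).matrix_conjTranspose (continuous_eval X)
  · exact isClosed_le continuous_const
      (continuous_const.dotProduct ((continuous_eval X).matrix_mulVec continuous_const))

/-- The dual cone as a pointed cone. -/
def dualPointedCone (C : Set (MatMap m n)) : PointedCone ℝ (MatMap m n) where
  carrier := dualCone C
  zero_mem' := ⟨fun _ _ => PosSemidef.zero, fun Θ _ => by simp [choi_zero]⟩
  add_mem' hΓ hΓ' := ⟨hΓ.1.add hΓ'.1, fun Θ hΘ => by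
    rw [choi_add, Matrix.add_mul, trace_add]
    exact add_nonneg (hΓ.2 Θ hΘ) (hΓ'.2 Θ hΘ)⟩
  smul_mem' a Γ hΓ := by
    refine ⟨fun X hX => (hΓ.1 X hX).smul a.2, fun Θ hΘ => ?_⟩
    have : choi (a • Γ) = (a : ℝ) • choi Γ := by
      ext
      simp only [choi_apply, Matrix.smul_apply]
      rfl
    rw [this, Matrix.smul_mul, trace_smul]
    exact smul_nonneg a.2 (hΓ.2 Θ hΘ)

theorem isClosed_dualCone (C : Set (MatMap m n)) : IsClosed (dualCone C) := by
  have : dualCone C = P m n ∩ ⋂ Θ ∈ C, {Γ | 0 ≤ (choi Γ * choi Θ).trace} := by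
    ext Γ
    simp [dualCone]
  rw [this]
  exact isClosed_P.inter (isClosed_biInter fun Θ _ => isClosed_le continuous_const
    (continuous_choi.matrix_mul continuous_const).matrix_trace)

theorem convCone_subset_dualCone {S C : Set (MatMap m n)} (h : S ⊆ dualCone C) :
    convCone S ⊆ dualCone C :=
  Set.sInter_subset_of_mem ⟨dualPointedCone C, rfl, isClosed_dualCone C, h⟩

/-- A Hermitian `Θ` pairing nonnegatively with every `Γ ∘ Ad V` is `k`-entanglement breaking. -/
theorem isKEB_of_forall_trace_nonneg {Θ : MatMap m n} (hΘ : (choi Θ).IsHermitian)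
    (h : ∀ Γ ∈ P k n, ∀ V : Matrix (Fin m) (Fin k) ℂ,
      0 ≤ (choi (Γ ∘ₗ conj V) * choi Θ).trace.re) : IsKEB k Θ := by
  have hsep : ∀ X : Mat₂ k m, X.PosSemidef → IsSeparableMatrix (ampliation k Θ X) := by
    intro X hX
    obtain ⟨r, V, rfl⟩ := exists_eq_sum_choi_conj hX
    rw [map_sum]
    refine IsSeparableMatrix.sum _ fun s _ => ?_
    rw [ampliation_choi]
    refine isSeparableMatrix_of_forall_isPositive ?_ fun Γ hΓ => ?_
    · rw [choi_comp_conj]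
      exact isHermitian_conjTranspose_mul_mul _ hΘ
    · rw [trace_choi_comp_conj_mul, trace_mul_comm]
      exact h Γ hΓ _
  exact ⟨fun X hX => (hsep X hX).posSemidef, hsep⟩

/-- Moving Ad_V to the other side leaves the positive map `Γ` paired with the separable matrix C_{Θ
∘ Ad_{V*}}. -/
theorem comp_conj_mem_dualCone {Γ : MatMap k n} (hΓ : Γ ∈ P k n)
    (V : Matrix (Fin m) (Fin k) ℂ) : Γ ∘ₗ conj V ∈ dualCone (EB k m n) := by
  refine ⟨IsPositive.comp hΓ (isPositive_conj V), fun Θ hΘ => ?_⟩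
  have hsep : IsSeparableMatrix (choi (Θ ∘ₗ conj Vᴴ)) := by
    rw [← ampliation_choi]
    refine hΘ.2 _ ?_
    rw [← LinearMap.id_comp (conj Vᴴ), choi_comp_conj]
    exact posSemidef_choi_id.conjTranspose_mul_mul_same _
  rw [trace_choi_comp_conj_mul, trace_mul_comm]
  exact IsPositive.trace_mul_choi_nonneg hΓ hsep

/-- A functional separating `Φ` from a closed cone containing `S` is represented by a map in EB_k,
which contradicts `Φ` lying in the dual. -/
theorem dualCone_subset_convCone {S : Set (MatMap m n)}
    (hS : ∀ Γ ∈ P k n, ∀ V : Matrix (Fin m) (Fin k) ℂ, Γ ∘ₗ conj V ∈ S) :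
    dualCone (EB k m n) ⊆ convCone S := by
  rintro Φ hΦ _ ⟨K, rfl, hK, hSK⟩
  by_contra hns
  let C : ProperCone ℝ (MatMap m n) := ⟨K, hK⟩
  obtain ⟨f, hf, hfΦ⟩ := C.hyperplane_separation_point (x₀ := Φ) hns
  obtain ⟨H, hH, hfH⟩ := Matrix.exists_isHermitian_trace_mul_eq
    ((f : MatMap m n →ₗ[ℝ] ℝ) ∘ₗ ((choiEquiv m n).symm.toLinearMap.restrictScalars ℝ))
  -- The representation of `f` holds only on Hermitian Choi matrices, which positive maps have.
  have hpair : ∀ Ψ : MatMap m n, Ψ.IsPositive → (choi Ψ * choi (ofChoi H)).trace = f Ψ := by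
    intro Ψ hΨ
    rw [choi_ofChoi, hfH _ hΨ.isHermitian_choi]
    simp [choiEquiv, ofChoi_choi]
  have hEB : ofChoi H ∈ EB k m n := by
    refine isKEB_of_forall_trace_nonneg (by rwa [choi_ofChoi]) fun Γ hΓ V => ?_
    rw [hpair _ (IsPositive.comp hΓ (isPositive_conj V)), Complex.ofReal_re]
    exact hf _ (hSK (hS Γ hΓ V))
  have h1 := hΦ.2 _ hEB
  rw [hpair _ hΦ.1] at h1
  exact absurd hfΦ (not_lt.mpr (by exact_mod_cast h1))

theorem comp_sum_mem_dualCone {l : ℕ} {C : Set (MatMap m n)} {Γ : MatMap l n} {r : ℕ}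
    {Ψ : Fin r → MatMap m l} (h : ∀ s, Γ ∘ₗ Ψ s ∈ dualCone C) :
    Γ ∘ₗ (∑ s, Ψ s) ∈ dualCone C := by
  have : Γ ∘ₗ (∑ s, Ψ s) = ∑ s, Γ ∘ₗ Ψ s := by
    ext1 X
    simp
  rw [this]
  exact Submodule.sum_mem (dualPointedCone C) fun s _ => h s

/-- Every `V : m × k` is `V' W` with `V'` square and of rank at most `k`. -/
theorem exists_square_mul_eq (V : Matrix (Fin m) (Fin k) ℂ) :
    ∃ (V' : Mat m) (W : Matrix (Fin m) (Fin k) ℂ), V'.rank ≤ k ∧ V = V' * W := by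
  rcases le_total m k with h | h
  · exact ⟨1, V, (rank_le_width _).trans h, (Matrix.one_mul V).symm⟩
  -- `Eᵀ` includes ℂ^k as the first `k` coordinates of ℂ^m.
  · let E : Matrix (Fin k) (Fin m) ℂ := of fun i j => if Fin.castLE h i = j then 1 else 0
    have hE : E * Eᵀ = 1 := by
      ext i j
      simp [E, mul_apply, one_apply, eq_comm]
    refine ⟨V * E, Eᵀ, ?_, ?_⟩
    · exact (rank_mul_le_left V E).trans (rank_le_width V)
    · rw [Matrix.mul_assoc, hE, Matrix.mul_one]

theorem isPEB_conj {V : Matrix (Fin m) (Fin n) ℂ} (hV : V.rank ≤ k) : IsPEB k (conj V) :=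
  ⟨isCP_conj V, 1, fun _ => V, fun _ => hV, fun X => by simp [conj_apply]⟩

end MatMap

end

theorem mainTheorem3 (d₁ d₂ k : ℕ) (hk : 1 ≤ k) :
    MatMap.dualCone (MatMap.EB k d₁ d₂) =
        MatMap.convCone {Θ : MatMap d₁ d₂ |
          ∃ Γ ∈ MatMap.P d₁ d₂, ∃ Ψ ∈ MatMap.PEB k d₁ d₁, Θ = Γ ∘ₗ Ψ} ∧
      MatMap.dualCone (MatMap.EB k d₁ d₂) =
        MatMap.convCone {Θ : MatMap d₁ d₂ |
          ∃ Γ ∈ MatMap.P k d₂, ∃ Ψ ∈ MatMap.CP d₁ k, Θ = Γ ∘ₗ Ψ} := by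
  refine ⟨Set.Subset.antisymm (MatMap.dualCone_subset_convCone fun Γ hΓ V => ?_)
      (MatMap.convCone_subset_dualCone ?_),
    Set.Subset.antisymm (MatMap.dualCone_subset_convCone fun Γ hΓ V => ?_)
      (MatMap.convCone_subset_dualCone ?_)⟩
  -- Ad_W is absorbed into the positive map, leaving the square factor of rank at most `k` as the
  -- k-PEB map.
  · obtain ⟨V', W, hV', rfl⟩ := MatMap.exists_square_mul_eq V
    refine ⟨Γ ∘ₗ MatMap.conj W, MatMap.IsPositive.comp hΓ (MatMap.isPositive_conj W),
      MatMap.conj V', MatMap.isPEB_conj hV', ?_⟩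
    rw [LinearMap.comp_assoc, MatMap.conj_comp_conj]
  · rintro _ ⟨Γ, hΓ, Ψ, ⟨-, r, V, hV, hΨ⟩, rfl⟩
    have hΨ' : Ψ = ∑ s, MatMap.conj (V s) := by
      ext1 X
      simp [hΨ, MatMap.conj_apply]
    rw [hΨ']
    refine MatMap.comp_sum_mem_dualCone fun s => ?_
    -- A Kraus operator of rank at most `k` makes the map factor through M_k; Ad_C joins `Γ`.
    obtain ⟨B, C, hBC⟩ := (V s).exists_mul_eq_of_rank_le (hV s)
    rw [hBC, ← MatMap.conj_comp_conj, ← LinearMap.comp_assoc]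
    exact MatMap.comp_conj_mem_dualCone (MatMap.IsPositive.comp hΓ (MatMap.isPositive_conj C)) B
  · exact ⟨Γ, hΓ, MatMap.conj V, MatMap.isCP_conj V, rfl⟩
  · rintro _ ⟨Γ, hΓ, Ψ, hΨ, rfl⟩
    obtain ⟨r, V, rfl⟩ := MatMap.IsCP.exists_eq_sum_conj hΨ
    exact MatMap.comp_sum_mem_dualCone fun s => MatMap.comp_conj_mem_dualCone hΓ (V s)
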